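/- Let $\mathcal A$ be a finite alphabet, $L\ge 2$, and let $\varrho\colon\mathcal A\to\mathcal A^L$ be a substitution of constant length $L$ that is \emph{bijective} (for each $0\le j\le L-1$ the column $a\mapsto\varrho(a)_j$ is a bijection of $\mathcal A$) and \emph{primitive} (for some $k$, every word $\varrho^k(a)$ with $a\in\mathcal A$ contains all letters of $\mathcal A$). Let $\mathbb X_\varrho\subseteq\mathcal A^{\mathbb Z}$ be its hull, that is, the subshift of all two-sided sequences each of whose finite subwords is a subword of $\varrho^k(a)$ for some $k\ge1$ and $a\in\mathcal A$, and suppose that $\varrho$ is \emph{aperiodic}, that is, no $x\in\mathbb X_\varrho$ satisfies $\sigma^n x=x$ for some $n\neq0$, where $(\sigma x)_m=x_{m+1}$. Let $\mathcal S(\mathbb X_\varrho)$ be the group of all homeomorphisms of $\mathbb X_\varrho$ that commute with the shift $\sigma$. Let $G$ be a group and let $\varphi\colon\mathbb Z\times G\to\mathcal S(\mathbb X_\varrho)$ be a group isomorphism. Then $G$ acts freely on $\mathcal A$ through $\varphi$: there is an action of $G$ on $\mathcal A$ such that $$\varphi(0,g)(x)_n=g\cdot x_n\qquad\text{for all } g\in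 G,\ x\in\mathbb X_\varrho,\ n\in\mathbb Z,$$ and all its stabilisers $\mathrm{Stab}_G(a)$, $a\in\mathcal A$, are trivial. Consequently, $G$ is finite and $|G|$ divides $|\mathcal A|$. -/

import Mathlib

/-- The shift by `n` on two-sided sequences over `A`: `(σₙ x) m = x (n + m)`. -/
def shift {A : Type*} (n : ℤ) (x : ℤ → A) : ℤ → A := fun m => x (n + m)

/-- A (one-dimensional) subshift: a closed, shift-invariant set of two-sided sequences.
The full shift carries the product topology; `A` will always be discrete. -/
structure Subshift (A : Type*) [TopologicalSpace A] where
  carrier : Set (ℤ → A)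
  isClosed_carrier : IsClosed carrier
  shift_mem : ∀ (n : ℤ), ∀ x ∈ carrier, shift n x ∈ carrier

namespace Subshift

variable {A : Type*} [TopologicalSpace A]

/-- The shift by `n` as a self-homeomorphism of the subshift. -/
def shiftHomeo (X : Subshift A) (n : ℤ) : X.carrier ≃ₜ X.carrier where
  toFun x := ⟨shift n x.1, X.shift_mem n x.1 x.2⟩
  invFun x := ⟨shift (-n) x.1, X.shift_mem (-n) x.1 x.2⟩
  left_inv x := by
    apply Subtype.ext
    funext m
    simp [shift]
  right_inv x := by
    apply Subtype.ext
    funext m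
    simp [shift]
  continuous_toFun := by
    refine Continuous.subtype_mk (continuous_pi fun m => ?_) _
    exact (continuous_apply (n + m)).comp continuous_subtype_val
  continuous_invFun := by
    refine Continuous.subtype_mk (continuous_pi fun m => ?_) _
    exact (continuous_apply (-n + m)).comp continuous_subtype_val

/-- The symmetry group of a subshift: all self-homeomorphisms (under composition) that commute
with every shift. -/
def symmetryGroup (X : Subshift A) : Subgroup (X.carrier ≃ₜ X.carrier) :=
  Subgroup.centralizer (Set.range X.shiftHomeo)

/-- A subshift is aperiodic if none of its elements has a non-zero period. -/
def IsAperiodic (X : Subshift A) : Prop :=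
  ∀ x ∈ X.carrier, ∀ n : ℤ, n ≠ 0 → shift n x ≠ x

end Subshift

/-- A substitution of constant length `L` on the alphabet `A`: `ρ a j` is the `j`-th letter of the
word `ρ(a)`. -/
abbrev ConstLengthSubstitution (A : Type*) (L : ℕ) : Type _ := A → Fin L → A

namespace ConstLengthSubstitution

variable {A : Type*} {L : ℕ}

/-- The substitution applied to a finite word, by concatenation. -/
def onWord (ρ : ConstLengthSubstitution A L) (w : List A) : List A :=
  w.flatMap fun a => List.ofFn (ρ a)

/-- The word `ρᵏ(a)`. -/
def iter (ρ : ConstLengthSubstitution A L) (k : ℕ) (a : A) : List A :=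
  ρ.onWord^[k] [a]

/-- Bijective: every column `a ↦ ρ(a)ⱼ` is a bijection of the alphabet. -/
def IsBijective (ρ : ConstLengthSubstitution A L) : Prop :=
  ∀ j : Fin L, Function.Bijective fun a => ρ a j

/-- Primitive: for some `k`, every word `ρᵏ(a)` contains all letters. -/
def IsPrimitive (ρ : ConstLengthSubstitution A L) : Prop :=
  ∃ k : ℕ, ∀ a b : A, b ∈ ρ.iter k a

/-- The language of `ρ`: all subwords (contiguous factors) of the words `ρᵏ(a)`, `k ≥ 1`. -/
def language (ρ : ConstLengthSubstitution A L) : Set (List A) :=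
  {w | ∃ k : ℕ, 1 ≤ k ∧ ∃ a : A, w <:+: ρ.iter k a}

/-- The word `x m, x (m+1), …, x (m+n-1)`. -/
def window (x : ℤ → A) (m : ℤ) (n : ℕ) : List A :=
  List.ofFn fun i : Fin n => x (m + (i : ℕ))

/-- The substitutive subshift (hull) of `ρ`: all two-sided sequences all of whose finite subwords
lie in the language of `ρ`. -/
def hull [TopologicalSpace A] [DiscreteTopology A] (ρ : ConstLengthSubstitution A L) :
    Subshift A where
  carrier := {x | ∀ (m : ℤ) (n : ℕ), window x m n ∈ ρ.language}
  isClosed_carrier := by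
    simp only [Set.ofPred_forall]
    refine isClosed_iInter fun m => isClosed_iInter fun n => ?_
    have hc : Continuous fun x : ℤ → A => fun i : Fin n => x (m + (i : ℕ)) :=
      continuous_pi fun i => continuous_apply _
    exact (isClosed_discrete {u : Fin n → A | List.ofFn u ∈ ρ.language}).preimage hc
  shift_mem := by
    intro n x hx m k
    have h : window (shift n x) m k = window x (n + m) k := by
      simp [window, shift, add_assoc]
    rw [h]
    exact hx (n + m) k

end ConstLengthSubstitution

/-! A symmetry F is a sliding block code of some radius r. Write x = ρᵏ(y) with Lᵏ large compared
with r, and F x as a translate of some ρᵏ(z). If a block boundary of F x fell more than r inside the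
blocks of x, each letter y q would determine both z q and z (q + 1), bijectively, so y would obey y
(q + 1) = h (y q) with h a permutation and be periodic. Hence boundaries move by at most r, and
bijectivity of the columns gives z = f ∘ y. Comparing two levels shows that f commutes with the
columns of some ρᵖ, so F is f followed by a shift, on one point and then, by minimality, everywhere
(`exists_letter_map`).

Some positive power of every symmetry is thus a pure shift. If φ(1, g) had a non-zero shift part, a
non-trivial power of φ(τ, 1), τ generating ℤ, would be a power of φ(1, g) or its inverse, which the
direct product forbids. So G acts by letter maps. A letter map fixing a letter fixes all of them by
primitivity (`IsPrimitive.eq_id_of_commute_column`), so the action is free. -/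

namespace ConstLengthSubstitution

/-! ### Columns of the powers of ρ, and inflation of sequences. -/

section Columns

variable {A : Type*} {L : ℕ} [NeZero L] (ρ : ConstLengthSubstitution A L)

/-- The column of `ρᵏ` at an integer position, read modulo `Lᵏ`. -/
def column : ℕ → ℤ → A → A
  | 0, _, a => a
  | k + 1, m, a => ρ (column k (m / L) a) (Fin.ofNat L (m % L).toNat)

/-- The two-sided sequence `ρᵏ(y)`, with a block boundary at the origin. -/
def inflate (k : ℕ) (y : ℤ → A) (m : ℤ) : A := ρ.column k m (y (m / (L : ℤ) ^ k))

lemma length_pos_int : (0 : ℤ) < L := by exact_mod_cast Nat.pos_of_ne_zero (NeZero.ne L)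

/-- The k lowest base-L digits of m act last; the remaining digits, m / Lᵏ, locate the letter of
ρˡ(a) whose image under ρᵏ covers m. -/
lemma column_add (k l : ℕ) (m : ℤ) (a : A) :
    ρ.column (k + l) m a = ρ.column k m (ρ.column l (m / (L : ℤ) ^ k) a) := by
  induction k generalizing m with
  | zero => simp [column]
  | succ k ih =>
    rw [Nat.succ_add]
    simp only [column]
    rw [ih, pow_succ', Int.ediv_ediv_of_nonneg (length_pos_int (L := L)).le]

lemma inflate_add (k l : ℕ) (y : ℤ → A) :
    ρ.inflate (k + l) y = ρ.inflate k (ρ.inflate l y) := by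
  funext m
  simp only [inflate]
  rw [column_add, pow_add, Int.ediv_ediv_of_nonneg (pow_pos (length_pos_int (L := L)) k).le]

lemma column_add_mul (k : ℕ) (m q : ℤ) : ρ.column k (m + q * (L : ℤ) ^ k) = ρ.column k m := by
  induction k generalizing m with
  | zero => rfl
  | succ k ih =>
    funext a
    have h : m + q * (L : ℤ) ^ (k + 1) = m + q * (L : ℤ) ^ k * L := by ring
    simp only [column, h]
    rw [Int.add_mul_ediv_right _ _ (length_pos_int (L := L)).ne', Int.add_mul_emod_self_right, ih]

lemma inflate_add_mul (k : ℕ) (y : ℤ → A) (m q : ℤ) :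
    ρ.inflate k y (m + q * (L : ℤ) ^ k) = ρ.inflate k (shift q y) m := by
  simp only [inflate, column_add_mul, shift]
  rw [Int.add_mul_ediv_right _ _ (pow_pos (length_pos_int (L := L)) k).ne', add_comm]

lemma inflate_block (k : ℕ) (y : ℤ → A) (q s : ℤ) (h0 : 0 ≤ s) (h1 : s < (L : ℤ) ^ k) :
    ρ.inflate k y (s + q * (L : ℤ) ^ k) = ρ.column k s (y q) := by
  rw [inflate_add_mul]
  simp [inflate, shift, Int.ediv_eq_zero_of_lt h0 h1]

lemma column_zero_iterate (k : ℕ) (a : A) : ρ.column k 0 a = (ρ.column 1 0)^[k] a := by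
  induction k with
  | zero => rfl
  | succ k ih =>
    rw [Function.iterate_succ_apply', ← ih]
    simp [column]

variable {ρ}

lemma IsBijective.column (hbij : ρ.IsBijective) (k : ℕ) (m : ℤ) :
    Function.Bijective (ρ.column k m) := by
  induction k generalizing m with
  | zero => exact Function.bijective_id
  | succ k ih => exact (hbij (Fin.ofNat L (m % L).toNat)).comp (ih (m / L))

variable (ρ)

lemma iter_eq_ofFn (k : ℕ) (a : A) :
    ρ.iter k a = List.ofFn fun i : Fin (L ^ k) => ρ.column k ((i : ℕ) : ℤ) a := by
  induction k with
  | zero => simp [iter, column]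
  | succ k ih =>
    have h : ρ.iter (k + 1) a = ρ.onWord (ρ.iter k a) := by
      simp [iter, Function.iterate_succ_apply']
    have e : List.ofFn (fun i : Fin (L ^ (k + 1)) => ρ.column (k + 1) ((i : ℕ) : ℤ) a) =
        List.ofFn (fun i : Fin (L ^ k * L) => ρ.column (k + 1) ((i : ℕ) : ℤ) a) := by
      rw [List.ofFn_congr (pow_succ L k)]
      rfl
    rw [h, ih, e, List.ofFn_mul, onWord, List.flatMap, List.map_ofFn]
    congr 2
    funext i
    simp only [Function.comp]
    congr 1
    funext j
    simp only [column]
    have h1 : (((i : ℕ) * L + (j : ℕ) : ℕ) : ℤ) / L = ((i : ℕ) : ℤ) := by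
      norm_cast
      rw [mul_comm, Nat.mul_add_div (Nat.pos_of_ne_zero (NeZero.ne L)), Nat.div_eq_of_lt j.2,
        add_zero]
    have h2 : ((((i : ℕ) * L + (j : ℕ) : ℕ) : ℤ) % L).toNat = j := by
      norm_cast
      rw [mul_comm, Nat.mul_add_mod, Nat.mod_eq_of_lt j.2]
    rw [h1, h2]
    congr 1
    simp

lemma window_mem_language_iff (x : ℤ → A) (m : ℤ) (n : ℕ) :
    window x m n ∈ ρ.language ↔ ∃ k : ℕ, 1 ≤ k ∧ ∃ a : A, ∃ s : ℕ, s + n ≤ L ^ k ∧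
      ∀ i : ℕ, i < n → x (m + i) = ρ.column k ((s + i : ℕ) : ℤ) a := by
  simp only [language, Set.mem_ofPred_eq, iter_eq_ofFn, window]
  refine exists_congr fun k => and_congr_right fun _ => exists_congr fun a => ?_
  rw [List.infix_iff_getElem?]
  simp only [List.length_ofFn]
  refine exists_congr fun s => ?_
  rw [add_comm n s]
  refine and_congr_right fun hs => forall_congr' fun i => forall_congr' fun hi => ?_
  rw [List.getElem?_eq_getElem (by simp; omega)]
  simp [add_comm, eq_comm]

variable {ρ}

lemma IsPrimitive.exists_column (hprim : ρ.IsPrimitive) :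
    ∃ k : ℕ, ∀ a b : A, ∃ s : ℤ, 0 ≤ s ∧ s < (L : ℤ) ^ k ∧ ρ.column k s a = b := by
  obtain ⟨k, hk⟩ := hprim
  refine ⟨k, fun a b => ?_⟩
  have h := hk a b
  rw [iter_eq_ofFn, List.mem_ofFn] at h
  obtain ⟨i, hi⟩ := h
  exact ⟨((i : ℕ) : ℤ), by positivity, by exact_mod_cast i.2, hi⟩

lemma commute_column_mul {f : A → A} {p : ℕ}
    (hf : ∀ (m : ℤ) (a : A), f (ρ.column p m a) = ρ.column p m (f a)) (t : ℕ) (m : ℤ) (a : A) :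
    f (ρ.column (p * t) m a) = ρ.column (p * t) m (f a) := by
  induction t generalizing m with
  | zero => rfl
  | succ t ih => rw [Nat.mul_succ, add_comm, column_add, column_add, hf, ih]

lemma IsPrimitive.eq_id_of_commute_column (hprim : ρ.IsPrimitive) {f : A → A} {p : ℕ} (hp : 0 < p)
    (hf : ∀ (m : ℤ) (a : A), f (ρ.column p m a) = ρ.column p m (f a)) {a : A} (ha : f a = a)
    (b : A) : f b = b := by
  obtain ⟨k, hk⟩ := hprim.exists_column
  -- Commutation holds only at levels divisible by p. Level p * k is reached from k by first
  -- applying l columns at position 0; ρᵏ of the resulting letter still contains b.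
  obtain ⟨l, hl⟩ := Nat.exists_eq_add_of_le (Nat.le_mul_of_pos_left k hp)
  obtain ⟨s, h0, h1, hs⟩ := hk (ρ.column l 0 a) b
  have h := commute_column_mul hf k s a
  rw [hl, column_add, Int.ediv_eq_zero_of_lt h0 h1, hs, ha] at h
  rw [h, column_add, Int.ediv_eq_zero_of_lt h0 h1, hs]

end Columns

/-! ### Desubstitution and minimality of the hull. -/

section Hull

lemma exists_eventually_eq_of_finite {ι B : Type*} [Finite B] (U : Ultrafilter ι) (u : ι → B) :
    ∃ b, ∀ᶠ i in (U : Filter ι), u i = b := by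
  obtain ⟨b, hb⟩ := (U.map u).eq_pure_of_finite
  have : ({b} : Set B) ∈ U.map u := by
    rw [hb]
    exact Set.mem_singleton b
  exact ⟨b, this⟩

variable {A : Type*} [Finite A] [TopologicalSpace A] [DiscreteTopology A] {L : ℕ} [NeZero L]
  {ρ : ConstLengthSubstitution A L}

/-- A compactness argument: each finite window of x lies in some ρ(ρᵏ(a)), hence desubstitutes
approximately, and the approximations converge along an ultrafilter. -/
lemma exists_eq_inflate_one (hL : 1 < L) {x : ℤ → A} (hx : x ∈ ρ.hull.carrier) :
    ∃ y ∈ ρ.hull.carrier, ∃ j : ℤ, ∀ m, x m = ρ.inflate 1 y (m + j) := by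
  have hL0 : (0 : ℤ) < L := length_pos_int
  have key : ∀ N : ℕ, ∃ (j : Fin L) (v : ℤ → A),
      (∀ m : ℤ, -N ≤ m → m ≤ N → x m = ρ.inflate 1 v (m + (j : ℕ))) ∧
      ∀ (m : ℤ) (n : ℕ), L * (|m| + n + 2) ≤ N → window v m n ∈ ρ.language := by
    intro N
    obtain ⟨k, hk, a, s, hs, h⟩ := (ρ.window_mem_language_iff x (-N) (2 * N + 1)).1 (hx _ _)
    obtain ⟨k, rfl⟩ := Nat.exists_eq_add_of_le hk
    set t : ℤ := ((N : ℤ) + s) / L with ht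
    have hj0 := Int.emod_nonneg ((N : ℤ) + s) hL0.ne'
    have hj1 := Int.emod_lt_of_pos ((N : ℤ) + s) hL0
    have hdiv := Int.mul_ediv_add_emod ((N : ℤ) + s) L
    set j : ℤ := ((N : ℤ) + s) % L with hj
    have hjn : ((j.toNat : ℕ) : ℤ) = j := Int.toNat_of_nonneg hj0
    refine ⟨⟨j.toNat, by omega⟩, fun q => ρ.column k (q + t) a, ?_, ?_⟩
    · intro m hm1 hm2
      have e := h (m + N).toNat (by omega)
      have e1 : (-(N : ℤ) + ((m + N).toNat : ℕ)) = m := by omega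
      have e2 : ((s + (m + N).toNat : ℕ) : ℤ) = (m + j) + t * (L : ℤ) ^ 1 := by
        push_cast
        rw [Int.toNat_of_nonneg (by omega)]
        linarith
      rw [e1, e2, column_add, column_add_mul, pow_one,
        Int.add_mul_ediv_right _ _ hL0.ne'] at e
      simp only [inflate, hjn, pow_one]
      exact e
    · intro m n hmn
      rw [window_mem_language_iff]
      have ha1 := neg_abs_le m
      have ha2 := le_abs_self m
      have hpow : (s : ℤ) + (2 * N + 1) ≤ L * (L : ℤ) ^ k := by
        have : (s : ℤ) + (2 * N + 1) ≤ (L : ℤ) ^ (1 + k) := by exact_mod_cast hs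
        rwa [pow_add, pow_one] at this
      have hlo : 0 ≤ m + t := by
        by_contra hneg
        have : (L : ℤ) * (m + t + 1) ≤ 0 := by nlinarith
        nlinarith
      have hhi : m + t + n ≤ (L : ℤ) ^ k := by
        by_contra hneg
        have : (L : ℤ) * ((L : ℤ) ^ k + 1) ≤ L * (m + t + n) := by
          apply mul_le_mul_of_nonneg_left _ hL0.le
          omega
        nlinarith
      refine ⟨k, ?_, a, (m + t).toNat, ?_, ?_⟩
      -- For k = 0 the window would lie in a word of length L, but N ≥ 2L.
      · by_contra hk0
        have : k = 0 := by omega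
        subst this
        have : (L : ℤ) * 2 ≤ N := by
          have : 0 ≤ |m| + (n : ℤ) := by positivity
          nlinarith
        simp at hpow
        omega
      · have : (((m + t).toNat + n : ℕ) : ℤ) ≤ ((L ^ k : ℕ) : ℤ) := by
          push_cast
          rw [Int.toNat_of_nonneg hlo]
          exact hhi
        exact_mod_cast this
      · intro i _
        have : (((m + t).toNat + i : ℕ) : ℤ) = m + i + t := by omega
        rw [this]
  choose j v hv hlang using key
  let U : Ultrafilter ℕ := Filter.hyperfilter ℕ
  have large : ∀ c : ℤ, ∀ᶠ N : ℕ in (U : Filter ℕ), c ≤ N := by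
    intro c
    have h1 : (U : Filter ℕ) ≤ Filter.atTop := Nat.hyperfilter_le_atTop
    have h2 : ∀ᶠ N : ℕ in Filter.atTop, c ≤ N := by
      filter_upwards [Filter.eventually_ge_atTop c.toNat] with N hN
      omega
    exact h1 h2
  obtain ⟨j', hj'⟩ := exists_eventually_eq_of_finite U j
  choose y hy using fun q : ℤ => exists_eventually_eq_of_finite U fun N => v N q
  refine ⟨y, ?_, (j' : ℕ), ?_⟩
  · intro m n
    have h1 : ∀ᶠ N in (U : Filter ℕ), ∀ i : Fin n, v N (m + (i : ℕ)) = y (m + (i : ℕ)) :=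
      Filter.eventually_all.2 fun i => hy _
    obtain ⟨N, hN1, hN2⟩ := (h1.and (large (L * (|m| + n + 2)))).exists
    have h2 : window y m n = window (v N) m n := by
      unfold window
      congr 1
      funext i
      exact (hN1 i).symm
    rw [h2]
    exact hlang N m n hN2
  · intro m
    obtain ⟨N, ⟨hN1, hN2⟩, hN3⟩ :=
      ((hj'.and (hy ((m + (j' : ℕ)) / (L : ℤ) ^ 1))).and (large |m|)).exists
    rw [hv N m (by linarith [neg_abs_le m]) (by linarith [le_abs_self m]), hN1]
    simp only [inflate]
    rw [hN2]

lemma exists_eq_inflate (hL : 1 < L) (k : ℕ) {x : ℤ → A} (hx : x ∈ ρ.hull.carrier) :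
    ∃ y ∈ ρ.hull.carrier, ∃ j : ℤ, ∀ m, x m = ρ.inflate k y (m + j) := by
  induction k with
  | zero => exact ⟨x, hx, 0, fun m => by simp [inflate, column]⟩
  | succ k ih =>
    obtain ⟨y, hy, j, h⟩ := ih
    obtain ⟨z, hz, i, h'⟩ := exists_eq_inflate_one hL hy
    refine ⟨z, hz, j + i * (L : ℤ) ^ k, fun m => ?_⟩
    have e : y = shift i (ρ.inflate 1 z) := by
      funext q
      rw [h' q, shift, add_comm]
    rw [h m, e, inflate_add, ← add_assoc, inflate_add_mul]

lemma exists_apply_eq (hL : 1 < L) (hprim : ρ.IsPrimitive) {x : ℤ → A} (hx : x ∈ ρ.hull.carrier)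
    (b : A) : ∃ m, x m = b := by
  obtain ⟨k, hk⟩ := hprim.exists_column
  obtain ⟨y, -, j, h⟩ := exists_eq_inflate hL k hx
  obtain ⟨s, h0, h1, hs⟩ := hk (y 0) b
  refine ⟨s - j, ?_⟩
  rw [h, sub_add_cancel, inflate, Int.ediv_eq_zero_of_lt h0 h1, hs]

/-- Every finite pattern of a point of the hull occurs in every other point. -/
lemma exists_forall_eq_shift (hL : 1 < L) (hprim : ρ.IsPrimitive) {x x' : ℤ → A}
    (hx : x ∈ ρ.hull.carrier) (hx' : x' ∈ ρ.hull.carrier) (r : ℕ) :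
    ∃ t : ℤ, ∀ m : ℤ, -r ≤ m → m ≤ r → x' m = shift t x m := by
  obtain ⟨k, -, a, s, hs, h⟩ := (ρ.window_mem_language_iff x' (-r) (2 * r + 1)).1 (hx' _ _)
  obtain ⟨y, hy, j, hj⟩ := exists_eq_inflate hL k hx
  obtain ⟨q, hq⟩ := exists_apply_eq hL hprim hy a
  -- The block ρᵏ(y q) starts at q * Lᵏ - j in x; the pattern starts s further on, and its centre
  -- lies another r beyond.
  refine ⟨s + r + q * (L : ℤ) ^ k - j, fun m h1 h2 => ?_⟩
  have e := h (m + r).toNat (by omega)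
  have e1 : (-(r : ℤ) + ((m + r).toNat : ℕ)) = m := by omega
  have e2 : ((s + (m + r).toNat : ℕ) : ℤ) = s + r + m := by omega
  have e3 : (s : ℤ) + (2 * r + 1) ≤ (L : ℤ) ^ k := by exact_mod_cast hs
  rw [e1, e2] at e
  rw [e, shift, hj]
  have e4 : s + r + q * (L : ℤ) ^ k - j + m + j = (s + r + m) + q * (L : ℤ) ^ k := by ring
  rw [e4, inflate_block _ _ _ _ _ (by omega) (by omega), hq]

end Hull

end ConstLengthSubstitution

/-! ### Sliding block codes. -/

namespace Subshift

variable {A : Type*} [TopologicalSpace A]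

/-- The value at `m` of `F x` depends only on the values of `x` at distance at most `r` from `m`. -/
def HasRadius (X : Subshift A) (F : X.carrier → X.carrier) (r : ℕ) : Prop :=
  ∀ (x x' : X.carrier) (m m' : ℤ),
    (∀ i : ℤ, -r ≤ i → i ≤ r → (x : ℤ → A) (m + i) = (x' : ℤ → A) (m' + i)) →
    (F x : ℤ → A) m = (F x' : ℤ → A) m'

variable {X : Subshift A}

/-- A continuous shift-commuting self-map of a subshift is a sliding block code. -/
lemma exists_hasRadius [Finite A] [DiscreteTopology A] {F : X.carrier → X.carrier}
    (hF : Continuous F) (hcomm : ∀ n x, F (X.shiftHomeo n x) = X.shiftHomeo n (F x)) :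
    ∃ r, X.HasRadius F r := by
  have : CompactSpace X.carrier :=
    isCompact_iff_compactSpace.1 X.isClosed_carrier.isCompact
  suffices h : ∃ r : ℕ, ∀ x ∈ (Set.univ : Set X.carrier), ∀ x' : X.carrier,
      (∀ i : ℤ, -r ≤ i → i ≤ r → (x : ℤ → A) i = (x' : ℤ → A) i) →
      (F x : ℤ → A) 0 = (F x' : ℤ → A) 0 by
    obtain ⟨r, hr⟩ := h
    refine ⟨r, fun x x' m m' hx => ?_⟩
    have e := hr (X.shiftHomeo m x) trivial (X.shiftHomeo m' x') hx
    rw [hcomm, hcomm] at e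
    simpa [shiftHomeo, shift] using e
  refine isCompact_univ.induction_on (p := fun S : Set X.carrier => ∃ r : ℕ, ∀ x ∈ S,
      ∀ x' : X.carrier, (∀ i : ℤ, -r ≤ i → i ≤ r → (x : ℤ → A) i = (x' : ℤ → A) i) →
      (F x : ℤ → A) 0 = (F x' : ℤ → A) 0) ⟨0, by simp⟩ ?_ ?_ ?_
  · rintro S T hST ⟨r, hr⟩
    exact ⟨r, fun x hx => hr x (hST hx)⟩
  · rintro S T ⟨r, hr⟩ ⟨s, hs⟩
    refine ⟨max r s, fun x hx x' h => ?_⟩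
    rcases hx with hx | hx
    · exact hr x hx x' fun i h1 h2 => h i (by push_cast; omega) (by push_cast; omega)
    · exact hs x hx x' fun i h1 h2 => h i (by push_cast; omega) (by push_cast; omega)
  · intro x _
    have hc : Continuous fun x' : X.carrier => (F x' : ℤ → A) 0 :=
      (continuous_apply 0).comp (continuous_subtype_val.comp hF)
    have hn : {x' : X.carrier | (F x' : ℤ → A) 0 = (F x : ℤ → A) 0} ∈ nhds x :=
      hc.tendsto x (mem_nhds_discrete.2 (Set.mem_singleton _))
    rw [nhds_subtype_eq_comap, Filter.mem_comap] at hn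
    obtain ⟨V, hV, hVs⟩ := hn
    rw [nhds_pi, Filter.mem_pi] at hV
    obtain ⟨I, hI, t, ht, hIt⟩ := hV
    obtain ⟨r, hr⟩ : ∃ r : ℕ, ∀ i ∈ I, -(r : ℤ) ≤ i ∧ i ≤ r := by
      obtain ⟨b, hb⟩ := (hI.image Int.natAbs).bddAbove
      refine ⟨b, fun i hi => ?_⟩
      have := hb ⟨i, hi, rfl⟩
      omega
    have agree : ∀ x' : X.carrier,
        (∀ i : ℤ, -r ≤ i → i ≤ r → (x : ℤ → A) i = (x' : ℤ → A) i) →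
        (F x' : ℤ → A) 0 = (F x : ℤ → A) 0 := by
      intro x' h
      refine hVs (hIt fun i hi => ?_)
      rw [← h i (hr i hi).1 (hr i hi).2]
      exact mem_of_mem_nhds (ht i)
    refine ⟨{x' | ∀ i ∈ Set.Icc (-(r : ℤ)) r, (x' : ℤ → A) i = (x : ℤ → A) i},
      mem_nhdsWithin_of_mem_nhds ?_, r, ?_⟩
    · have : {x' : X.carrier | ∀ i ∈ Set.Icc (-(r : ℤ)) r, (x' : ℤ → A) i = (x : ℤ → A) i} =
          ⋂ i ∈ Set.Icc (-(r : ℤ)) r, {x' : X.carrier | (x' : ℤ → A) i = (x : ℤ → A) i} := by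
        ext
        simp
      rw [this, Filter.biInter_mem (Set.finite_Icc _ _)]
      intro i _
      exact ((continuous_apply i).comp continuous_subtype_val).tendsto x
        (mem_nhds_discrete.2 (Set.mem_singleton _))
    · intro y hy x' h
      rw [agree y fun i h1 h2 => (hy i ⟨h1, h2⟩).symm,
        agree x' fun i h1 h2 => (hy i ⟨h1, h2⟩).symm.trans (h i h1 h2)]

end Subshift

lemma exists_iterate_eq_self {A : Type*} [Finite A] {h : A → A} (hinj : Function.Injective h) :
    ∃ n : ℕ, 0 < n ∧ ∀ a, h^[n] a = a := by
  let e : Equiv.Perm A := Equiv.ofBijective h (Finite.injective_iff_bijective.1 hinj)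
  refine ⟨orderOf e, orderOf_pos e, fun a => ?_⟩
  have he : h = ⇑e := rfl
  rw [he, Equiv.Perm.iterate_eq_pow, pow_orderOf_eq_one, Equiv.Perm.one_apply]

/-- A two-sided sequence over a finite alphabet obeying an invertible one-step recursion is
periodic. -/
lemma exists_shift_eq_of_forall_succ {A : Type*} [Finite A] {y : ℤ → A} (h : A → A)
    (hinj : Function.Injective h) (hy : ∀ q, y (q + 1) = h (y q)) :
    ∃ n : ℤ, n ≠ 0 ∧ shift n y = y := by
  have hiter : ∀ (k : ℕ) (q : ℤ), y (k + q) = h^[k] (y q) := by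
    intro k
    induction k with
    | zero => simp
    | succ k ih =>
      intro q
      rw [Function.iterate_succ_apply', ← ih, ← hy]
      congr 1
      push_cast
      ring
  obtain ⟨n, hn, hid⟩ := exists_iterate_eq_self hinj
  refine ⟨n, by exact_mod_cast hn.ne', ?_⟩
  funext q
  rw [shift, hiter, hid]

/-! ### Rigidity of block codes on the hull. -/

namespace ConstLengthSubstitution

variable {A : Type*} [TopologicalSpace A] [DiscreteTopology A] {L : ℕ} [NeZero L]
  {ρ : ConstLengthSubstitution A L}

/-- Inside a block, the image under a sliding block code only depends on the block. -/
lemma apply_block_eq {F : ρ.hull.carrier → ρ.hull.carrier} {r k : ℕ}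
    (hr : ρ.hull.HasRadius F r) {x : ρ.hull.carrier} {y : ℤ → A}
    (hx : (x : ℤ → A) = ρ.inflate k y) {q q' : ℤ} (hq : y q = y q') (s : ℤ)
    (h1 : (r : ℤ) ≤ s) (h2 : s + r < (L : ℤ) ^ k) :
    (F x : ℤ → A) (s + q * (L : ℤ) ^ k) = (F x : ℤ → A) (s + q' * (L : ℤ) ^ k) := by
  refine hr x x _ _ fun i hi1 hi2 => ?_
  rw [hx, add_right_comm _ _ i, add_right_comm _ _ i,
    inflate_block _ _ _ _ _ (by omega) (by omega),
    inflate_block _ _ _ _ _ (by omega) (by omega), hq]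

lemma exists_map_of_forall_eq {B C ι : Type*} {y : ι → B} (hy : Function.Surjective y)
    {z : ι → C} (h : ∀ q q', y q = y q' → z q = z q') : ∃ f : B → C, ∀ q, z q = f (y q) := by
  refine ⟨fun b => z (hy b).choose, fun q => h _ _ (hy (y q)).choose_spec.symm⟩

variable [Finite A]

/-- Sliding block codes move the block boundaries by at most their radius. -/
lemma exists_eq_inflate_of_hasRadius (hL : 1 < L) (hbij : ρ.IsBijective) (hprim : ρ.IsPrimitive)
    (haper : ρ.hull.IsAperiodic) {F : ρ.hull.carrier → ρ.hull.carrier} {r k : ℕ}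
    (hr : ρ.hull.HasRadius F r) (hk : 2 * (r : ℤ) < (L : ℤ) ^ k) {x : ρ.hull.carrier} {y : ℤ → A}
    (hy : y ∈ ρ.hull.carrier) (hx : (x : ℤ → A) = ρ.inflate k y) :
    ∃ z ∈ ρ.hull.carrier, ∃ n : ℤ, |n| ≤ r ∧
      ∀ m, (F x : ℤ → A) m = ρ.inflate k z (m + n) := by
  have hLk : (0 : ℤ) < (L : ℤ) ^ k := pow_pos length_pos_int k
  obtain ⟨z', hz', i', h'⟩ := exists_eq_inflate hL k (F x).2
  obtain ⟨z, hz, i, hi0, hi1, h⟩ : ∃ z ∈ ρ.hull.carrier, ∃ i : ℤ, 0 ≤ i ∧ i < (L : ℤ) ^ k ∧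
      ∀ m, (F x : ℤ → A) m = ρ.inflate k z (m + i) := by
    refine ⟨shift (i' / (L : ℤ) ^ k) z', ρ.hull.shift_mem _ _ hz', i' % (L : ℤ) ^ k,
      Int.emod_nonneg _ hLk.ne', Int.emod_lt_of_pos _ hLk, fun m => ?_⟩
    rw [h', ← inflate_add_mul, add_assoc]
    congr 2
    rw [mul_comm, Int.emod_add_mul_ediv]
  by_cases hir : i ≤ r
  · exact ⟨z, hz, i, by rwa [abs_of_nonneg hi0], h⟩
  by_cases hir' : (L : ℤ) ^ k - i ≤ r
  · refine ⟨shift 1 z, ρ.hull.shift_mem _ _ hz, i - (L : ℤ) ^ k, ?_, fun m => ?_⟩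
    · rw [abs_of_nonpos (by omega)]
      omega
    · rw [h, ← inflate_add_mul]
      congr 1
      ring
  -- The boundary of F x now sits at offset Lᵏ - i, strictly between r and Lᵏ - r, in each block of
  -- x. The offsets r and Lᵏ - r - 1, both determined by y q, then lie in the blocks of z q and z (q
  -- + 1).
  exfalso
  push Not at hir hir'
  have hysurj : Function.Surjective y := exists_apply_eq hL hprim hy
  have hzsurj : Function.Surjective z := exists_apply_eq hL hprim hz
  obtain ⟨f, hf⟩ : ∃ f : A → A, ∀ q, z q = f (y q) := by
    refine exists_map_of_forall_eq hysurj fun q q' hq => ?_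
    have e := apply_block_eq hr hx hq r le_rfl (by omega)
    rw [h, h, add_right_comm, add_right_comm _ _ i,
      inflate_block _ _ _ _ _ (by omega) (by omega),
      inflate_block _ _ _ _ _ (by omega) (by omega)] at e
    exact (hbij.column k _).1 e
  obtain ⟨g, hg⟩ : ∃ g : A → A, ∀ q, z (q + 1) = g (y q) := by
    refine exists_map_of_forall_eq hysurj fun q q' hq => ?_
    have e := apply_block_eq hr hx hq ((L : ℤ) ^ k - r - 1) (by omega) (by omega)
    have e1 : ∀ q : ℤ, (L : ℤ) ^ k - r - 1 + q * (L : ℤ) ^ k + i =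
        (i - r - 1) + (q + 1) * (L : ℤ) ^ k := fun q => by ring
    rw [h, h, e1, e1, inflate_block _ _ _ _ _ (by omega) (by omega),
      inflate_block _ _ _ _ _ (by omega) (by omega)] at e
    exact (hbij.column k _).1 e
  have hfsurj : Function.Surjective f := fun b => by
    obtain ⟨q, rfl⟩ := hzsurj b
    exact ⟨y q, (hf q).symm⟩
  have hgsurj : Function.Surjective g := fun b => by
    obtain ⟨q, rfl⟩ := hzsurj b
    exact ⟨y (q - 1), by rw [← hg, sub_add_cancel]⟩
  have hfb : Function.Bijective f := Finite.surjective_iff_bijective.1 hfsurj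
  have hgb : Function.Bijective g := Finite.surjective_iff_bijective.1 hgsurj
  obtain ⟨n, hn, hny⟩ := exists_shift_eq_of_forall_succ (y := y)
    ((Equiv.ofBijective f hfb).symm ∘ g) ((Equiv.injective _).comp hgb.1) fun q => by
      rw [Function.comp, Equiv.eq_symm_apply, ← hg, hf]
      rfl
  exact haper y hy n hn hny

/-- The rigidity of sliding block codes: each is a letter-to-letter map followed by a shift, and
the letter map commutes with the columns of a power of the substitution. -/
lemma exists_letter_map (hL : 1 < L) (hbij : ρ.IsBijective) (hprim : ρ.IsPrimitive)
    (haper : ρ.hull.IsAperiodic) {F : ρ.hull.carrier → ρ.hull.carrier} {r : ℕ}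
    (hr : ρ.hull.HasRadius F r) (x₀ : ρ.hull.carrier) :
    ∃ (n : ℤ) (f : A → A) (p : ℕ), 0 < p ∧
      (∀ m a, f (ρ.column p m a) = ρ.column p m (f a)) ∧
      ∀ (x : ρ.hull.carrier) (m : ℤ), (F x : ℤ → A) m = f ((x : ℤ → A) (n + m)) := by
  obtain ⟨p, hp, hp0⟩ : ∃ p : ℕ, 0 < p ∧ ∀ a, ρ.column p 0 a = a := by
    obtain ⟨p, hp, hid⟩ := exists_iterate_eq_self (hbij.column 1 0).1
    exact ⟨p, hp, fun a => by rw [column_zero_iterate, hid]⟩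
  -- A multiple of p, so that commutation with level p passes to level K; the other factor forces Lᴷ
  -- > 4r, which keeps offset 2r, even moved by n, inside a block.
  set K : ℕ := p * (4 * r + 1) with hK
  have hbig : 4 * (r : ℤ) < (L : ℤ) ^ K := by
    have h1 : K < L ^ K := Nat.lt_pow_self hL
    have h2 : 4 * r + 1 ≤ K := Nat.le_mul_of_pos_left _ hp
    have : 4 * r < L ^ K := by omega
    exact_mod_cast this
  have hbig' : 4 * (r : ℤ) < (L : ℤ) ^ (K + p) :=
    hbig.trans_le (pow_le_pow_right₀ (by exact_mod_cast hL.le) (Nat.le_add_right _ _))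
  obtain ⟨y, hy, j, hj⟩ := exists_eq_inflate hL (K + p) x₀.2
  let x : ρ.hull.carrier := ρ.hull.shiftHomeo (-j) x₀
  have hx : (x : ℤ → A) = ρ.inflate (K + p) y := by
    funext m
    change (x₀ : ℤ → A) (-j + m) = _
    rw [hj]
    congr 1
    ring
  obtain ⟨z, hz, n, hn, hFx⟩ := exists_eq_inflate_of_hasRadius hL hbij hprim haper hr
    (by omega) hy hx
  have hn' := abs_le.1 hn
  -- At every level below the top one, the code acts on blocks through a letter map.
  have level : ∀ (k : ℕ) (u v : ℤ → A), 4 * (r : ℤ) < (L : ℤ) ^ k → Function.Surjective u →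
      (x : ℤ → A) = ρ.inflate k u → (∀ m, (F x : ℤ → A) m = ρ.inflate k v (m + n)) →
      ∃ f : A → A, ∀ q, v q = f (u q) := by
    intro k u v hk hu hxu hv
    refine exists_map_of_forall_eq hu fun q q' hq => ?_
    have e := apply_block_eq hr hxu hq (2 * r) (by omega) (by omega)
    rw [hv, hv, add_right_comm, add_right_comm _ _ n,
      inflate_block _ _ _ _ _ (by omega) (by omega),
      inflate_block _ _ _ _ _ (by omega) (by omega)] at e
    exact (hbij.column k _).1 e
  have hysurj : Function.Surjective y := exists_apply_eq hL hprim hy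
  have hblock : ∀ (w : ℤ → A) (q : ℤ), ρ.inflate p w (q * (L : ℤ) ^ p) = w q := by
    intro w q
    have := ρ.inflate_block p w q 0 le_rfl (pow_pos length_pos_int p)
    rwa [zero_add, hp0] at this
  obtain ⟨f, hf⟩ := level (K + p) y z hbig' hysurj hx hFx
  obtain ⟨f', hf'⟩ := level K (ρ.inflate p y) (ρ.inflate p z) hbig
    (fun b => by
      obtain ⟨q, rfl⟩ := hysurj b
      exact ⟨_, hblock y q⟩)
    (by rw [hx, inflate_add]) (by simpa only [inflate_add] using hFx)
  -- As column 0 of ρᵖ is the identity, the first letter of each ρᵖ-block of `inflate p y` is a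
  -- letter of y, and likewise for z.
  have hff : f' = f := by
    funext b
    obtain ⟨q, rfl⟩ := hysurj b
    have := hf' (q * (L : ℤ) ^ p)
    rw [hblock, hblock] at this
    rw [← this, hf]
  subst hff
  have hcol : ∀ m a, f' (ρ.column p m a) = ρ.column p m (f' a) := by
    intro m a
    obtain ⟨q, rfl⟩ := hysurj a
    have e := hf' (m % (L : ℤ) ^ p + q * (L : ℤ) ^ p)
    have hLp : (0 : ℤ) < (L : ℤ) ^ p := pow_pos length_pos_int p
    rw [inflate_block _ _ _ _ _ (Int.emod_nonneg _ hLp.ne') (Int.emod_lt_of_pos _ hLp),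
      inflate_block _ _ _ _ _ (Int.emod_nonneg _ hLp.ne') (Int.emod_lt_of_pos _ hLp), hf] at e
    have hm : ρ.column p (m % (L : ℤ) ^ p) = ρ.column p m := by
      conv_rhs => rw [← Int.emod_add_mul_ediv m ((L : ℤ) ^ p), mul_comm, column_add_mul]
    rw [hm] at e
    exact e.symm
  have hFx' : ∀ m, (F x : ℤ → A) m = f' ((x : ℤ → A) (n + m)) := by
    intro m
    rw [hFx, hx, inflate_add, inflate_add, add_comm n m]
    change ρ.column K _ (ρ.inflate p z _) = f' (ρ.column K _ (ρ.inflate p y _))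
    rw [hf', hK, commute_column_mul hcol]
  refine ⟨n, f', p, hp, hcol, fun x' m => ?_⟩
  -- Minimality: the radius-r pattern of x' around m recurs in x around t. Since |n| ≤ r, it also
  -- contains the letter at offset n.
  obtain ⟨t, ht⟩ := exists_forall_eq_shift hL hprim x.2 (ρ.hull.shift_mem m _ x'.2) r
  have e : (F x' : ℤ → A) m = (F x : ℤ → A) t := hr x' x m t ht
  rw [e, hFx', add_comm n m, add_comm n t]
  exact congrArg f' (ht n hn'.1 hn'.2).symm

end ConstLengthSubstitution

/-! ### Powers of symmetries, and counting for free actions. -/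

namespace Subshift

variable {A : Type*} [TopologicalSpace A] {X : Subshift A}

lemma symmetryGroup_apply_shiftHomeo (F : X.symmetryGroup) (n : ℤ) (x : X.carrier) :
    (F : X.carrier ≃ₜ X.carrier) (X.shiftHomeo n x) =
      X.shiftHomeo n ((F : X.carrier ≃ₜ X.carrier) x) := by
  have h := Subgroup.mem_centralizer_iff.1 F.2 (X.shiftHomeo n) ⟨n, rfl⟩
  exact (congrArg (fun e : X.carrier ≃ₜ X.carrier => e x) h).symm

lemma symmetryGroup_pow_apply {F : X.symmetryGroup} {n : ℤ} {f : A → A}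
    (h : ∀ (x : X.carrier) (m : ℤ),
      ((F : X.carrier ≃ₜ X.carrier) x : ℤ → A) m = f ((x : ℤ → A) (n + m)))
    (k : ℕ) (x : X.carrier) (m : ℤ) :
    (((F ^ k : X.symmetryGroup) : X.carrier ≃ₜ X.carrier) x : ℤ → A) m =
      f^[k] ((x : ℤ → A) (k * n + m)) := by
  induction k generalizing m with
  | zero => simp
  | succ k ih =>
    rw [pow_succ', Function.iterate_succ_apply']
    change ((F : X.carrier ≃ₜ X.carrier) (((F ^ k : X.symmetryGroup) : X.carrier ≃ₜ X.carrier) x) :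
      ℤ → A) m = _
    rw [h, ih]
    refine congrArg (fun i => f (f^[k] ((x : ℤ → A) i))) ?_
    push_cast
    ring

lemma symmetryGroup_ext {F F' : X.symmetryGroup}
    (h : ∀ (x : X.carrier) (m : ℤ), ((F : X.carrier ≃ₜ X.carrier) x : ℤ → A) m =
      ((F' : X.carrier ≃ₜ X.carrier) x : ℤ → A) m) : F = F' := by
  apply Subtype.ext
  apply Homeomorph.ext
  intro x
  apply Subtype.ext
  funext m
  exact h x m

end Subshift

lemma MulAction.card_dvd_card_of_stabilizer_eq_bot {G A : Type*} [Group G] [MulAction G A]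
    [Finite A] (h : ∀ a : A, MulAction.stabilizer G a = ⊥) : Nat.card G ∣ Nat.card A := by
  have e : A ≃ (Σ _ : MulAction.orbitRel.Quotient G A, G) :=
    (MulAction.selfEquivSigmaOrbitsQuotientStabilizer G A).trans <|
      Equiv.sigmaCongrRight fun ω =>
        (Subgroup.quotientEquivOfEq (h ω.out)).trans
          (QuotientGroup.quotientBot (G := G)).toEquiv
  rw [Nat.card_congr (e.trans (Equiv.sigmaEquivProd _ _)), Nat.card_prod]
  exact dvd_mul_left _ _

/-! ### The action of G. -/

open ConstLengthSubstitution in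
theorem mainTheorem5 {A : Type*} [Fintype A] [TopologicalSpace A] [DiscreteTopology A]
    {L : ℕ} (hL : 1 < L) (ρ : ConstLengthSubstitution A L)
    (hbij : ρ.IsBijective) (hprim : ρ.IsPrimitive) (haper : ρ.hull.IsAperiodic)
    {G : Type*} [Group G] (φ : Multiplicative ℤ × G ≃* ρ.hull.symmetryGroup) :
    (∃ _ : MulAction G A,
      (∀ (g : G) (x : ρ.hull.carrier) (n : ℤ),
        ((φ (1, g) : ρ.hull.carrier ≃ₜ ρ.hull.carrier) x : ℤ → A) n = g • (x : ℤ → A) n) ∧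
      ∀ a : A, MulAction.stabilizer G a = ⊥) ∧
    Finite G ∧ Nat.card G ∣ Fintype.card A := by
  have : NeZero L := ⟨by omega⟩
  let τ : Multiplicative ℤ := Multiplicative.ofAdd 1
  -- An empty hull would have a trivial symmetry group, too small for the factor ℤ.
  obtain ⟨x₀⟩ : Nonempty ρ.hull.carrier := by
    by_contra hemp
    rw [not_nonempty_iff] at hemp
    have h1 : φ (τ, 1) = φ 1 := Subshift.symmetryGroup_ext fun x => isEmptyElim x
    have h2 : τ = 1 := congrArg Prod.fst (φ.injective h1)
    exact absurd (congrArg Multiplicative.toAdd h2) one_ne_zero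
  have hsurj : Function.Surjective (x₀ : ℤ → A) := exists_apply_eq hL hprim x₀.2
  have structureThm : ∀ F : ρ.hull.symmetryGroup, ∃ (n : ℤ) (f : A → A) (p : ℕ), 0 < p ∧
      (∀ m a, f (ρ.column p m a) = ρ.column p m (f a)) ∧
      ∀ (x : ρ.hull.carrier) (m : ℤ),
        ((F : ρ.hull.carrier ≃ₜ ρ.hull.carrier) x : ℤ → A) m = f ((x : ℤ → A) (n + m)) := by
    intro F
    obtain ⟨r, hr⟩ := Subshift.exists_hasRadius
      (F : ρ.hull.carrier ≃ₜ ρ.hull.carrier).continuous (Subshift.symmetryGroup_apply_shiftHomeo F)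
    exact exists_letter_map hL hbij hprim haper hr x₀
  have power : ∀ F : ρ.hull.symmetryGroup, ∀ (n : ℤ) (f : A → A),
      (∀ (x : ρ.hull.carrier) (m : ℤ),
        ((F : ρ.hull.carrier ≃ₜ ρ.hull.carrier) x : ℤ → A) m = f ((x : ℤ → A) (n + m))) →
      ∃ k : ℕ, 0 < k ∧ ∀ (l : ℕ) (x : ρ.hull.carrier) (m : ℤ),
        (((F ^ (k * l) : ρ.hull.symmetryGroup) : ρ.hull.carrier ≃ₜ ρ.hull.carrier) x : ℤ → A) m =
          (x : ℤ → A) (k * l * n + m) := by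
    intro F n f h
    have hf : Function.Surjective f := by
      intro b
      obtain ⟨q, hq⟩ := exists_apply_eq hL hprim
        ((F : ρ.hull.carrier ≃ₜ ρ.hull.carrier) x₀).2 b
      exact ⟨_, (h x₀ q).symm.trans hq⟩
    obtain ⟨k, hk, hid⟩ := exists_iterate_eq_self (Finite.injective_iff_surjective.2 hf)
    refine ⟨k, hk, fun l x m => ?_⟩
    have hid' : f^[k] = id := funext hid
    rw [Subshift.symmetryGroup_pow_apply h, Function.iterate_mul, hid', Function.iterate_id]
    push_cast
    rfl
  have letter : ∀ g : G, ∃ (f : A → A) (p : ℕ), 0 < p ∧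
      (∀ m a, f (ρ.column p m a) = ρ.column p m (f a)) ∧
      ∀ (x : ρ.hull.carrier) (m : ℤ),
        ((φ (1, g) : ρ.hull.carrier ≃ₜ ρ.hull.carrier) x : ℤ → A) m = f ((x : ℤ → A) m) := by
    intro g
    obtain ⟨n, f, p, hp, hcol, h⟩ := structureThm (φ (1, g))
    obtain ⟨a, f', -, -, -, h'⟩ := structureThm (φ (τ, 1))
    obtain ⟨k, hk, hF⟩ := power _ n f h
    obtain ⟨k', hk', hT⟩ := power _ a f' h'
    -- φ need not send τ to the shift, so the shift part a of φ(τ, 1) is arbitrary. The exponents N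
    -- * |a| and N * |n| give both powers the same shift up to sign, and the ℤ-coordinate then
    -- forces N * |n| = 0.
    have hn : n = 0 := by
      obtain ⟨N, hN, hn1, hn2⟩ : ∃ N : ℕ, 0 < N ∧
          (∀ (l : ℕ) x m, (((φ (1, g) ^ (N * l) : ρ.hull.symmetryGroup) :
            ρ.hull.carrier ≃ₜ ρ.hull.carrier) x : ℤ → A) m = (x : ℤ → A) (N * l * n + m)) ∧
          (∀ (l : ℕ) x m, (((φ (τ, 1) ^ (N * l) : ρ.hull.symmetryGroup) :
            ρ.hull.carrier ≃ₜ ρ.hull.carrier) x : ℤ → A) m = (x : ℤ → A) (N * l * a + m)) := by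
        refine ⟨k * k', Nat.mul_pos hk hk', fun l x m => ?_, fun l x m => ?_⟩
        · rw [mul_assoc, hF]
          refine congrArg (x : ℤ → A) ?_
          push_cast
          ring
        · rw [mul_comm k, mul_assoc, hT]
          refine congrArg (x : ℤ → A) ?_
          push_cast
          ring
      have hτ : τ ^ (N * n.natAbs) = 1 := by
        have hc : (a.natAbs : ℤ) * n = n.natAbs * a ∨ (a.natAbs : ℤ) * n + n.natAbs * a = 0 := by
          rcases Int.natAbs_eq a with ha | ha <;> rcases Int.natAbs_eq n with hb | hb <;>
            generalize a.natAbs = c at * <;> generalize n.natAbs = d at * <;> subst ha hb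
          · exact Or.inl (by ring)
          · exact Or.inr (by ring)
          · exact Or.inr (by ring)
          · exact Or.inl (by ring)
        rcases hc with hc | hc
        · have e : φ ((1, g) ^ (N * a.natAbs)) = φ ((τ, 1) ^ (N * n.natAbs)) := by
            refine Subshift.symmetryGroup_ext fun x m => ?_
            rw [map_pow, map_pow, hn1, hn2, mul_assoc, mul_assoc, hc]
          simpa using (congrArg Prod.fst (φ.injective e)).symm
        · have e : φ ((1, g) ^ (N * a.natAbs) * (τ, 1) ^ (N * n.natAbs)) = φ 1 := by
            refine Subshift.symmetryGroup_ext fun x m => ?_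
            rw [map_mul, map_pow, map_pow, map_one]
            refine (hn1 _ _ m).trans ((hn2 _ x _).trans (congrArg (x : ℤ → A) ?_))
            linear_combination (N : ℤ) * hc
          simpa using congrArg Prod.fst (φ.injective e)
      have h0 := congrArg Multiplicative.toAdd hτ
      simp only [τ, toAdd_pow, toAdd_ofAdd, toAdd_one, nsmul_eq_mul, mul_one] at h0
      have h1 : N * n.natAbs = 0 := by exact_mod_cast h0
      rcases Nat.mul_eq_zero.1 h1 with h1 | h1
      · omega
      · exact Int.natAbs_eq_zero.1 h1
    subst hn
    exact ⟨f, p, hp, hcol, fun x m => by rw [h, zero_add]⟩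
  choose f p hp hcol hf using letter
  have hone : ∀ a, f 1 a = a := by
    intro a
    obtain ⟨q, rfl⟩ := hsurj a
    rw [← hf, ← Prod.one_eq_mk, map_one]
    rfl
  have hmul : ∀ g h a, f (g * h) a = f g (f h a) := by
    intro g h a
    obtain ⟨q, rfl⟩ := hsurj a
    have e : ((1 : Multiplicative ℤ), g * h) = (1, g) * (1, h) := by simp
    rw [← hf, ← hf, ← hf, e, map_mul]
    rfl
  let act : MulAction G A :=
    { smul := fun g a => f g a
      one_smul := hone
      mul_smul := hmul }
  have hstab : ∀ a : A, MulAction.stabilizer G a = ⊥ := by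
    intro a
    refine (Subgroup.eq_bot_iff_forall _).2 fun g hg => ?_
    have hid := hprim.eq_id_of_commute_column (hp g) (hcol g) (MulAction.mem_stabilizer_iff.1 hg)
    have h1 : φ (1, g) = φ 1 := by
      refine Subshift.symmetryGroup_ext fun x m => ?_
      rw [hf, hid, map_one]
      rfl
    exact congrArg Prod.snd (φ.injective h1)
  refine ⟨⟨act, hf, hstab⟩, ?_, ?_⟩
  · refine Finite.of_injective (fun g : G => g • (x₀ : ℤ → A) 0) fun g h hgh => ?_
    have : h⁻¹ * g ∈ MulAction.stabilizer G ((x₀ : ℤ → A) 0) := by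
      rw [MulAction.mem_stabilizer_iff, mul_smul]
      exact inv_smul_eq_iff.2 hgh
    rw [hstab, Subgroup.mem_bot] at this
    exact (inv_mul_eq_one.1 this).symm
  · rw [← Nat.card_eq_fintype_card]
    exact MulAction.card_dvd_card_of_stabilizer_eq_bot hstab
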